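/- Notation. For $\tau\in\mathbb Z^d$ let $|\tau|=\max_j|\tau_j|$. A filter is a function $q:\mathbb Z^d\to\mathbb C$ with finitely many nonzero values; it has order at most $T$ if $q_\tau=0$ whenever $|\tau|>T$; $|q|_2=(\sum_\tau|q_\tau|^2)^{1/2}$, and $(q(\Delta)s)_t=\sum_\tau q_\tau s_{t-\tau}$ for a field $s:\mathbb Z^d\to\mathbb C$. Let $\theta\ge 0$, $\rho\ge 1$, $t\in\mathbb Z^d$, and let $L\ge 0$ be an integer. A random complex field $(s_\tau)_{\tau\in\mathbb Z^d}$ is well-filtered at $t$ with parameters $\theta,\rho,L$, written $(s_\tau)\in\mathbf F^t_L(\theta,\rho)$, if for every integer $T$ with $0\le T\le L$ there is a (deterministic) filter $q^{(T)}$ of order at most $T$ with $$|q^{(T)}|_2\le\frac{\rho}{(2T+1)^{d/2}}\quad\text{and}\quad \max_{\tau:\,|\tau-t|\le L}\left(E\left|s_\tau-(q^{(T)}(\Delta)s)_\tau\right|^2\right)^{1/2}\le\theta(2T+1)^{-d/2};$$ the filters $q^{(T)}$ are said to certify this inclusion. For a positive integer $M$ let $D_{2M}=\{x\in\mathbb R^d:|x_j|\le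 2M,\ j\le d\}$, and for a real $R>0$ let $\mathbf H(M,R)$ be the family of restrictions to $\mathbb Z^d$ of random functions $f:\mathbb R^d\to\mathbb C$, on any probability space, such that every realization of $f$ is continuous on $\mathbb R^d$ and harmonic in the interior of $D_{2M}$, and $E\{\sup_{x\in D_{2M}}|f(x)|^2\}\le R^2$. Proposition. There are an absolute constant $c\in(0,1]$ and filters $q^{(d,T)}$ on $\mathbb Z^d$, depending only on $d$ and $T$, such that the following holds for all $d\le 4$, all positive integers $M$, all reals $R>0$, all random fields $(s_\tau)\in\mathbf H(M,R)$, all $t\in\mathbb Z^d$ and all integers $L\ge 0$: if $|t|\le cM$ and $L\le cM$, then $$(s_\tau)\in\mathbf F^t_L(c^{-1}R,\,c^{-1}),$$ and this inclusion is certified by the filters $q^{(d,T)}$, $0\le T\le L$. -/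

import Mathlib

open MeasureTheory
open scoped ENNReal

namespace HarmFilt

/-- The lattice `ℤ^d`. -/
abbrev Lattice (d : ℕ) : Type := Fin d → ℤ

/-- `|τ| = max_j |τ_j|` (and `0` when `d = 0`). -/
def latticeNorm {d : ℕ} (τ : Lattice d) : ℕ :=
  Finset.univ.sup fun j => (τ j).natAbs

/-- A filter on `ℤ^d`: a complex-valued field on `ℤ^d` with finitely many nonzero entries. -/
abbrev LatticeFilter (d : ℕ) : Type := Lattice d →₀ ℂ

/-- `q ∈ C_T(ℤ^d)`: the filter `q` has order at most `T`. -/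
def OrderLE {d : ℕ} (q : LatticeFilter d) (T : ℕ) : Prop :=
  ∀ τ : Lattice d, T < latticeNorm τ → q τ = 0

/-- The norm `|q|_2`. -/
noncomputable def l2norm {d : ℕ} (q : LatticeFilter d) : ℝ :=
  Real.sqrt (q.sum fun _ a => ‖a‖ ^ 2)

/-- The output of the filter `q` on the input field `x`:
`(q(Δ)x)_t = ∑_τ q_τ x_{t-τ}`. -/
noncomputable def applyFilter {d : ℕ} (q : LatticeFilter d) (x : Lattice d → ℂ) :
    Lattice d → ℂ :=
  fun t => q.sum fun τ a => a * x (t - τ)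

/-- The filter `q` certifies that the random field `s` is `T`-well-filtered at `t` with parameters
`θ, ρ, L`: it has order at most `T`, satisfies `|q|_2 ≤ ρ (2T+1)^{-d/2}`, and for every `τ` in the
box `|τ - t| ≤ L` the mean square error `(E |s_τ - (q(Δ)s)_τ|²)^{1/2}` (the `L²`-norm `eLpNorm`,
with values in `[0,∞]`) is at most `θ (2T+1)^{-d/2}`. -/
def Certifies {d : ℕ} {Ω : Type*} [MeasurableSpace Ω] (P : Measure Ω) (q : LatticeFilter d)
    (s : Ω → Lattice d → ℂ) (t : Lattice d) (L : ℕ∞) (θ ρ : ℝ) (T : ℕ) : Prop :=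
  OrderLE q T ∧
  l2norm q ≤ ρ / (2 * (T : ℝ) + 1) ^ ((d : ℝ) / 2) ∧
  ∀ τ : Lattice d, (latticeNorm (τ - t) : ℕ∞) ≤ L →
    eLpNorm (fun ω => s ω τ - applyFilter q (s ω) τ) 2 P ≤
      ENNReal.ofReal (θ * (2 * (T : ℝ) + 1) ^ (-((d : ℝ) / 2)))

/-- `s ∈ S^t_L(θ, ρ, T)`: the random field `s` is `T`-well-filtered at `t`. -/
def TWellFiltered {d : ℕ} {Ω : Type*} [MeasurableSpace Ω] (P : Measure Ω)
    (s : Ω → Lattice d → ℂ) (t : Lattice d) (L : ℕ∞) (θ ρ : ℝ) (T : ℕ) : Prop :=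
  ∃ q : LatticeFilter d, Certifies P q s t L θ ρ T

/-- `s ∈ F^t_L(θ, ρ)`: the random field `s` is well-filtered at `t`. -/
def WellFiltered {d : ℕ} {Ω : Type*} [MeasurableSpace Ω] (P : Measure Ω)
    (s : Ω → Lattice d → ℂ) (t : Lattice d) (L : ℕ∞) (θ ρ : ℝ) : Prop :=
  ∀ T : ℕ, (T : ℕ∞) ≤ L → TWellFiltered P s t L θ ρ T

/-- The box `{x ∈ ℝ^d : |x_j| ≤ 2M for all j}`. -/
def box (d M : ℕ) : Set (EuclideanSpace ℝ (Fin d)) :=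
  {x | ∀ j, |x j| ≤ 2 * (M : ℝ)}

/-- Continuous functions on `ℝ^d` that are harmonic in the interior of the box. -/
def harmonicFunctions (d M : ℕ) : Set (EuclideanSpace ℝ (Fin d) → ℂ) :=
  {f | Continuous f ∧ InnerProductSpace.HarmonicOnNhd f (interior (box d M))}

/-- The uniform norm on the box, with values in `[0,∞]`. -/
noncomputable def boxNorm {d : ℕ} (M : ℕ) (f : EuclideanSpace ℝ (Fin d) → ℂ) : ℝ≥0∞ :=
  ⨆ x ∈ box d M, ‖f x‖ₑ

/-- Random functions on the probability space `(Ω, P)` all of whose realizations are continuous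
and harmonic in the interior of the box, and for which `E ‖f‖² ≤ R²`, where `‖·‖` is the uniform
norm on the box. -/
def randomHarmonicFunctions (d M : ℕ) (R : ℝ) {Ω : Type*} [MeasurableSpace Ω] (P : Measure Ω) :
    Set (Ω → EuclideanSpace ℝ (Fin d) → ℂ) :=
  {f | (∀ x, Measurable fun ω => f ω x) ∧
    (∀ ω, f ω ∈ harmonicFunctions d M) ∧
    ∫⁻ ω, boxNorm M (f ω) ^ 2 ∂P ≤ ENNReal.ofReal (R ^ 2)}

/-- The point of `ℝ^d` given by a lattice point. -/
noncomputable def latticePoint {d : ℕ} (τ : Lattice d) : EuclideanSpace ℝ (Fin d) :=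
  WithLp.toLp 2 fun j => (τ j : ℝ)

/-- The random fields on `ℤ^d` that are restrictions of the random functions above. -/
def randomHarmonicFields (d M : ℕ) (R : ℝ) {Ω : Type*} [MeasurableSpace Ω] (P : Measure Ω) :
    Set (Ω → Lattice d → ℂ) :=
  {s | ∃ f ∈ randomHarmonicFunctions d M R P, s = fun ω τ => f ω (latticePoint τ)}

end HarmFilt

/-!
The value of a harmonic function `f` at a point is the integral of `f` against a smooth radial
kernel `K` of unit mass centred there. Discretizing this integral on the lattice, at a scale
`1 / h` comparable to `T`, gives the filter of order at most `T`; its coefficients are of size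
`h ^ d`, which is the required bound for its `ℓ²`-norm.

The error of the discretization is governed by `Er g = ∫ g - ∑ g n`. Let `A g` be the average of `g`
over unit cubes with a corner at the given point. Since `Er (A g) = 0`, we have
`Er g = -Er (A g - g)`, and `A g - g` is an average of forward differences of `g`. Iterating `k`
times bounds `Er g` by the forward differences of order `k` of `g`. For `g y = K (h y) f (x - y)`
these are `O(h ^ k)`, and only a bound of `|f|` enters: a harmonic `F` is its own average against
`K`, so that `K z F z = ∫ K z K (w - z) F w dw`, where `z` occurs in the arguments of `K` only. With
`k = d` the relative error is `O(h ^ d)`, which suffices in every dimension.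
-/

namespace HarmFilt

open Metric Filter Topology InnerProductSpace Laplacian

section RadialBump

variable {E : Type*} [NormedAddCommGroup E]

/-- A smooth function on `ℝ`, positive for `u < 1` and zero for `1 ≤ u`. -/
noncomputable def radialProfile (u : ℝ) : ℝ := expNegInvGlue (1 - u)

/-- The primitive of `radialProfile` that vanishes for `1 ≤ u`; the gradient of
`radialPrimitive (‖y‖ ^ 2)` is `2 * radialBump y • y`. -/
noncomputable def radialPrimitive (u : ℝ) : ℝ := ∫ v in (1 : ℝ)..u, radialProfile v

/-- A smooth radial bump supported in the unit ball. -/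
noncomputable def radialBump (y : E) : ℝ := radialProfile (‖y‖ ^ 2)

lemma contDiff_radialProfile {n : ℕ∞} : ContDiff ℝ n radialProfile :=
  expNegInvGlue.contDiff.comp (contDiff_const.sub contDiff_id)

lemma radialProfile_eq_zero {u : ℝ} (hu : 1 ≤ u) : radialProfile u = 0 :=
  expNegInvGlue.zero_of_nonpos (by linarith)

lemma hasDerivAt_radialPrimitive (u : ℝ) : HasDerivAt radialPrimitive (radialProfile u) u :=
  ((contDiff_radialProfile (n := 0)).continuous.integral_hasStrictDerivAt 1 u).hasDerivAt

lemma contDiff_one_radialPrimitive : ContDiff ℝ 1 radialPrimitive := by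
  refine contDiff_one_iff_deriv.2
    ⟨fun u => (hasDerivAt_radialPrimitive u).differentiableAt, ?_⟩
  rw [funext fun u => (hasDerivAt_radialPrimitive u).deriv]
  exact (contDiff_radialProfile (n := 0)).continuous

lemma radialPrimitive_eq_zero {u : ℝ} (hu : 1 ≤ u) : radialPrimitive u = 0 :=
  intervalIntegral.integral_zero_ae <| ae_of_all _ fun v hv => by
    rw [Set.uIoc_of_le hu] at hv
    exact radialProfile_eq_zero hv.1.le

lemma radialBump_eq_zero {y : E} (hy : 1 ≤ ‖y‖) : radialBump y = 0 :=
  radialProfile_eq_zero (one_le_pow₀ hy)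

lemma hasCompactSupport_of_eq_zero {F : Type*} [Zero F] [ProperSpace E] {u : E → F} (r : ℝ)
    (hu : ∀ y, r ≤ ‖y‖ → u y = 0) : HasCompactSupport u :=
  HasCompactSupport.intro (isCompact_closedBall 0 r) fun y hy => hu y <| by
    rw [mem_closedBall_zero_iff, not_le] at hy
    exact hy.le

lemma hasCompactSupport_radialBump [ProperSpace E] : HasCompactSupport (radialBump : E → ℝ) :=
  hasCompactSupport_of_eq_zero 1 fun _ => radialBump_eq_zero

lemma hasCompactSupport_radialPrimitive_norm_sq [ProperSpace E] :
    HasCompactSupport fun y : E => radialPrimitive (‖y‖ ^ 2) :=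
  hasCompactSupport_of_eq_zero 1 fun _ hy => radialPrimitive_eq_zero (one_le_pow₀ hy)

variable [InnerProductSpace ℝ E]

lemma contDiff_radialBump {n : ℕ∞} : ContDiff ℝ n (radialBump : E → ℝ) :=
  contDiff_radialProfile.comp (contDiff_norm_sq ℝ)

lemma continuous_radialBump : Continuous (radialBump : E → ℝ) :=
  (contDiff_radialBump (n := 0)).continuous

lemma hasFDerivAt_radialPrimitive_norm_sq (y : E) :
    HasFDerivAt (fun y : E => radialPrimitive (‖y‖ ^ 2))
      ((2 * radialBump y) • innerSL ℝ y) y := by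
  refine ((hasDerivAt_radialPrimitive (‖y‖ ^ 2)).comp_hasFDerivAt y
    (hasStrictFDerivAt_norm_sq y).hasFDerivAt).congr_fderiv ?_
  rw [← Nat.cast_smul_eq_nsmul ℝ, smul_smul, mul_comm]
  rfl

lemma integral_radialBump_pos [FiniteDimensional ℝ E] [MeasurableSpace E] [BorelSpace E] :
    0 < ∫ y : E, radialBump y := by
  refine continuous_radialBump.integral_pos_of_hasCompactSupport_nonneg_nonzero (x := 0)
    hasCompactSupport_radialBump (fun y => expNegInvGlue.nonneg _) ?_
  simp [radialBump, radialProfile]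

end RadialBump

section MeanValue

lemma add_smul_mem_closedBall {E : Type*} [SeminormedAddCommGroup E] [NormedSpace ℝ E] {y : E}
    {R : ℝ} (hy : ‖y‖ ≤ R) (x : E) (r : ℝ) : x + r • y ∈ closedBall x (R * |r|) := by
  rw [mem_closedBall, dist_self_add_left, norm_smul, Real.norm_eq_abs, mul_comm]
  gcongr

variable {E F : Type*} [NormedAddCommGroup E] [InnerProductSpace ℝ E]
  [NormedAddCommGroup F] [NormedSpace ℝ F]

lemma sum_inner_smul_apply_orthonormalBasis {ι : Type*} [Fintype ι] (b : OrthonormalBasis ι ℝ E)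
    (G : E →L[ℝ] F) (y : E) : ∑ i, inner ℝ y (b i) • G (b i) = G y := by
  conv_rhs => rw [← b.sum_repr' y, map_sum]
  simp only [map_smul, real_inner_comm]

variable [FiniteDimensional ℝ E]

lemma sum_fderiv_fderiv_orthonormalBasis {ι : Type*} [Fintype ι] (b : OrthonormalBasis ι ℝ E)
    {g : E → F} (hg : ContDiff ℝ 2 g) (x : E) (r : ℝ) (y : E) :
    ∑ i, fderiv ℝ (fun y => fderiv ℝ g (x + r • y)) y (b i) (b i) = r • Δ g (x + r • y) := by
  have hdiff : HasFDerivAt (fun y => fderiv ℝ g (x + r • y))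
      ((fderiv ℝ (fderiv ℝ g) (x + r • y)).comp (r • ContinuousLinearMap.id ℝ E)) y :=
    (((hg.fderiv_right (m := 1) (by norm_num)).differentiable one_ne_zero
      (x + r • y)).hasFDerivAt).comp y (((hasFDerivAt_id y).const_smul r).const_add x)
  simp [hdiff.fderiv, laplacian_eq_iteratedFDeriv_orthonormalBasis g b, iteratedFDeriv_two_apply,
    Finset.smul_sum]

lemma exists_contDiff_hasCompactSupport_eventuallyEq {n : ℕ∞} {f : E → F} {s U : Set E}
    (hs : IsCompact s) (hU : IsOpen U) (hsU : s ⊆ U) (hf : ContDiffOn ℝ n f U) :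
    ∃ g : E → F, ContDiff ℝ n g ∧ HasCompactSupport g ∧ g =ᶠ[𝓝ˢ s] f := by
  obtain ⟨t, ht, hst, htU⟩ := exists_compact_between hs hU hsU
  obtain ⟨χ, hχ1, hχ0, -⟩ := exists_contMDiffMap_one_nhds_of_subset_interior
    (modelWithCornersSelf ℝ E) (n := n) hs.isClosed hst
  refine ⟨fun z => χ z • f z, contDiff_iff_contDiffAt.2 fun z => ?_,
    HasCompactSupport.intro ht fun z hz => by rw [hχ0 z hz, zero_smul],
    hχ1.mono fun z hz => by simp only [hz, one_smul]⟩
  by_cases hz : z ∈ t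
  · exact χ.contMDiff.contDiff.contDiffAt.smul (hf.contDiffAt (hU.mem_nhds (htU hz)))
  · refine contDiffAt_const (c := (0 : F)) |>.congr_of_eventuallyEq ?_
    filter_upwards [ht.isClosed.isOpen_compl.mem_nhds hz] with w hw
    rw [hχ0 w hw, zero_smul]

variable [MeasurableSpace E] [BorelSpace E]

lemma integral_smul_sum_fderiv_eq_neg {ι : Type*} [Fintype ι] (b : ι → E) {H : E → ℝ}
    {G : E → E →L[ℝ] F} (hH : ContDiff ℝ 1 H) (hHs : HasCompactSupport H) (hG : ContDiff ℝ 1 G) :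
    ∫ y, H y • ∑ i, fderiv ℝ G y (b i) (b i) = -∫ y, ∑ i, fderiv ℝ H y (b i) • G y (b i) := by
  have : Continuous (fderiv ℝ G) := hG.continuous_fderiv one_ne_zero
  have : Continuous (fderiv ℝ H) := hH.continuous_fderiv one_ne_zero
  have hGc := hG.continuous
  have hHc := hH.continuous
  have hint (i) : Integrable fun y => H y • fderiv ℝ G y (b i) (b i) :=
    (by fun_prop : Continuous _).integrable_of_hasCompactSupport hHs.smul_right
  have hint' (i) : Integrable fun y => fderiv ℝ H y (b i) • G y (b i) :=
    (by fun_prop : Continuous _).integrable_of_hasCompactSupport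
      (hHs.fderiv_apply ℝ (b i)).smul_right
  have hfderiv (i y) : fderiv ℝ (fun y => G y (b i)) y (b i) = fderiv ℝ G y (b i) (b i) := by
    rw [fderiv_clm_apply (hG.differentiable one_ne_zero y) (differentiableAt_const _)]
    simp
  have hparts (i) : ∫ y, H y • fderiv ℝ G y (b i) (b i) = -∫ y, fderiv ℝ H y (b i) • G y (b i) := by
    simp_rw [← hfderiv i]
    exact integral_smul_fderiv_eq_neg_fderiv_smul_of_integrable (hint' i)
      (by simpa only [hfderiv] using hint i)
      ((by fun_prop : Continuous _).integrable_of_hasCompactSupport hHs.smul_right)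
      (fun y _ => hH.differentiable one_ne_zero y)
      (fun y _ => (hG.differentiable one_ne_zero y).clm_apply (differentiableAt_const _))
  simp_rw [Finset.smul_sum]
  rw [integral_finsetSum _ fun i _ => hint i, integral_finsetSum _ fun i _ => hint' i,
    ← Finset.sum_neg_distrib]
  exact Finset.sum_congr rfl fun i _ => hparts i

lemma two_smul_integral_radialBump_smul_fderiv {g : E → F} (hg : ContDiff ℝ 2 g) (x : E) (r : ℝ) :
    (2 : ℝ) • ∫ y : E, radialBump y • fderiv ℝ g (x + r • y) y =
      -∫ y : E, radialPrimitive (‖y‖ ^ 2) • r • Δ g (x + r • y) := by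
  let b := stdOrthonormalBasis ℝ E
  have hG : ContDiff ℝ 1 fun y => fderiv ℝ g (x + r • y) :=
    (hg.fderiv_right (m := 1) (by norm_num)).comp (by fun_prop)
  have hgradient (y : E) : ∑ i, fderiv ℝ (fun y : E => radialPrimitive (‖y‖ ^ 2)) y (b i) •
      fderiv ℝ g (x + r • y) (b i) = (2 : ℝ) • radialBump y • fderiv ℝ g (x + r • y) y := by
    rw [← sum_inner_smul_apply_orthonormalBasis b, smul_smul, Finset.smul_sum]
    refine Finset.sum_congr rfl fun i _ => ?_
    rw [(hasFDerivAt_radialPrimitive_norm_sq y).fderiv, smul_smul]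
    rfl
  have hdiv := integral_smul_sum_fderiv_eq_neg b
    (contDiff_one_radialPrimitive.comp (contDiff_norm_sq ℝ))
    hasCompactSupport_radialPrimitive_norm_sq hG
  simp only [Function.comp_def, sum_fderiv_fderiv_orthonormalBasis b hg, hgradient] at hdiv
  rw [hdiv, neg_neg, integral_smul]

lemma integral_radialBump_smul_fderiv_eq_zero {g : E → F} (hg : ContDiff ℝ 2 g) {x : E} {r : ℝ}
    (hΔ : ∀ z ∈ closedBall x |r|, Δ g z = 0) :
    ∫ y : E, radialBump y • fderiv ℝ g (x + r • y) y = 0 := by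
  refine (smul_eq_zero.1 ?_).resolve_left (two_ne_zero (α := ℝ))
  rw [two_smul_integral_radialBump_smul_fderiv hg, neg_eq_zero]
  refine integral_eq_zero_of_ae (ae_of_all _ fun y => ?_)
  rcases le_total 1 ‖y‖ with hy | hy
  · simp [radialPrimitive_eq_zero (one_le_pow₀ hy)]
  · simp [hΔ _ (by simpa only [one_mul] using add_smul_mem_closedBall hy x r)]

lemma hasDerivAt_integral_radialBump_smul {g : E → F} (hg : ContDiff ℝ 1 g)
    (hgs : HasCompactSupport g) (x : E) (r : ℝ) :
    HasDerivAt (fun r : ℝ => ∫ y : E, radialBump y • g (x + r • y))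
      (∫ y : E, radialBump y • fderiv ℝ g (x + r • y) y) r := by
  have hbump : Continuous (radialBump : E → ℝ) := continuous_radialBump
  have hbumps : HasCompactSupport (radialBump : E → ℝ) := hasCompactSupport_radialBump
  have hgc := hg.continuous
  have hg' : Continuous (fderiv ℝ g) := hg.continuous_fderiv one_ne_zero
  obtain ⟨C, hC⟩ := (hgs.fderiv ℝ).exists_bound_of_continuous hg'
  refine (hasDerivAt_integral_of_dominated_loc_of_deriv_le (μ := volume) (s := Set.univ)
    (F := fun (r : ℝ) (y : E) => radialBump y • g (x + r • y))
    (F' := fun (r : ℝ) (y : E) => radialBump y • fderiv ℝ g (x + r • y) y)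
    (bound := fun y : E => ‖radialBump y‖ * (C * ‖y‖)) univ_mem
    (.of_forall fun r => (by fun_prop : Continuous _).aestronglyMeasurable)
    ((by fun_prop : Continuous _).integrable_of_hasCompactSupport hbumps.smul_right)
    (by fun_prop : Continuous _).aestronglyMeasurable
    (.of_forall fun y r _ => ?_)
    ((by fun_prop : Continuous _).integrable_of_hasCompactSupport hbumps.norm.mul_right)
    (.of_forall fun y r _ => ?_)).2
  · rw [norm_smul]
    gcongr
    exact (fderiv ℝ g _).le_of_opNorm_le (hC _) y
  · have hline : HasDerivAt (fun r : ℝ => x + r • y) y r := by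
      simpa using ((hasDerivAt_id r).smul_const y).const_add x
    exact ((hg.differentiable one_ne_zero _).hasFDerivAt.comp_hasDerivAt r hline).const_smul _

lemma integral_radialBump_smul_of_contDiff {g : E → F} (hg : ContDiff ℝ 2 g)
    (hgs : HasCompactSupport g) {x : E} {r : ℝ} (hΔ : ∀ z ∈ closedBall x |r|, Δ g z = 0) :
    ∫ y : E, radialBump y • g (x + r • y) = ∫ y : E, radialBump y • g x := by
  have hderiv := hasDerivAt_integral_radialBump_smul (hg.of_le one_le_two) hgs x
  have hzero (ρ : ℝ) (hρ : ρ ∈ segment ℝ 0 r) :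
      HasDerivWithinAt (fun ρ : ℝ => ∫ y : E, radialBump y • g (x + ρ • y)) 0
        (segment ℝ 0 r) ρ := by
    rw [← integral_radialBump_smul_fderiv_eq_zero hg (x := x) (r := ρ)
      fun z hz => hΔ z (closedBall_subset_closedBall ?_ hz)]
    · exact (hderiv ρ).hasDerivWithinAt
    · rw [segment_eq_uIcc] at hρ
      simpa using Set.abs_sub_left_of_mem_uIcc hρ
  have hle := (convex_segment (0 : ℝ) r).norm_image_sub_le_of_norm_hasDerivWithin_le
    (f' := fun _ => 0) hzero (fun _ _ => norm_zero.le) (left_mem_segment ℝ 0 r)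
    (right_mem_segment ℝ 0 r)
  simpa [sub_eq_zero] using hle

/-- The smooth radial kernel of integral one, supported in the unit ball, against which harmonic
functions are averaged. -/
noncomputable def meanKernel (y : E) : ℝ := (∫ z : E, radialBump z)⁻¹ * radialBump y

lemma contDiff_meanKernel {n : ℕ∞} : ContDiff ℝ n (meanKernel : E → ℝ) :=
  contDiff_const.mul contDiff_radialBump

lemma continuous_meanKernel : Continuous (meanKernel : E → ℝ) :=
  (contDiff_meanKernel (n := 0)).continuous

lemma meanKernel_eq_zero {y : E} (hy : 1 ≤ ‖y‖) : meanKernel y = 0 := by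
  rw [meanKernel, radialBump_eq_zero hy, mul_zero]

lemma hasCompactSupport_meanKernel : HasCompactSupport (meanKernel : E → ℝ) :=
  hasCompactSupport_of_eq_zero 1 fun _ => meanKernel_eq_zero

theorem integral_meanKernel_smul [CompleteSpace F] {f : E → F} {x : E} {r : ℝ}
    (hf : HarmonicOnNhd f (closedBall x |r|)) :
    ∫ y : E, meanKernel y • f (x + r • y) = f x := by
  obtain ⟨g, hg, hgs, hgf_nhds⟩ := exists_contDiff_hasCompactSupport_eventuallyEq (n := 2)
    (isCompact_closedBall x |r|) (isOpen_setOfPred_harmonicAt f) hf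
    (fun z hz => hz.1.contDiffWithinAt)
  have hgf {z} (hz : z ∈ closedBall x |r|) : g =ᶠ[𝓝 z] f :=
    hgf_nhds.filter_mono (nhds_le_nhdsSet hz)
  have hgΔ (z) (hz : z ∈ closedBall x |r|) : Δ g z = 0 :=
    (laplacian_congr_nhds (hgf hz)).eq_of_nhds.trans (hf z hz).2.eq_of_nhds
  have hbump (y : E) : radialBump y • f (x + r • y) = radialBump y • g (x + r • y) := by
    rcases le_total 1 ‖y‖ with hy | hy
    · simp only [radialBump_eq_zero hy, zero_smul]
    · rw [(hgf (by simpa only [one_mul] using add_smul_mem_closedBall hy x r)).eq_of_nhds]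
  simp_rw [meanKernel, mul_smul, hbump]
  rw [integral_smul, integral_radialBump_smul_of_contDiff hg hgs hgΔ, integral_smul_const,
    inv_smul_smul₀ integral_radialBump_pos.ne',
    (hgf (mem_closedBall_self (abs_nonneg r))).eq_of_nhds]

end MeanValue

section BoundedDifferences

variable {E F : Type*} [NormedAddCommGroup E] [NormedAddCommGroup F]

/-- The `k`-fold forward differences of `g` satisfy
`‖Δ_{v₁} ⋯ Δ_{v_k} g‖ ≤ C * ‖v₁‖ * ⋯ * ‖v_k‖` everywhere. -/
def BoundedDifferences : ℕ → ℝ → (E → F) → Prop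
  | 0, C, g => ∀ z, ‖g z‖ ≤ C
  | k + 1, C, g => ∀ v, BoundedDifferences k (C * ‖v‖) (fwdDiff v g)

namespace BoundedDifferences

variable {k : ℕ} {C C' : ℝ}

lemma mono {g : E → F} (hg : BoundedDifferences k C g) (hC : C ≤ C') :
    BoundedDifferences k C' g := by
  induction k generalizing C C' g with
  | zero => exact fun z => (hg z).trans hC
  | succ k ih => exact fun v => ih (hg v) (by gcongr)

lemma comp_add_clm {E' : Type*} [NormedAddCommGroup E'] [NormedSpace ℝ E'] [NormedSpace ℝ E]
    {g : E → F} (hg : BoundedDifferences k C g) (hC : 0 ≤ C) (a : E) (L : E' →L[ℝ] E) :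
    BoundedDifferences k (C * ‖L‖ ^ k) fun z => g (a + L z) := by
  induction k generalizing C g with
  | zero => exact fun z => by simpa using hg (a + L z)
  | succ k ih =>
    intro v
    have hdiff : fwdDiff v (fun z => g (a + L z)) = fun z => fwdDiff (L v) g (a + L z) := by
      ext z
      simp only [fwdDiff, map_add, add_assoc]
    rw [hdiff]
    refine (ih (hg (L v)) (by positivity)).mono ?_
    calc C * ‖L v‖ * ‖L‖ ^ k ≤ C * (‖L‖ * ‖v‖) * ‖L‖ ^ k := by gcongr; exact L.le_opNorm v
      _ = C * ‖L‖ ^ (k + 1) * ‖v‖ := by ring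

variable [NormedSpace ℝ F]

lemma smul_const {φ : E → ℝ} (hφ : BoundedDifferences k C φ) (w : F) :
    BoundedDifferences k (C * ‖w‖) fun z => φ z • w := by
  induction k generalizing C φ with
  | zero => exact fun z => by rw [norm_smul]; gcongr; exact hφ z
  | succ k ih =>
    intro v
    have hdiff : fwdDiff v (fun z => φ z • w) = fun z => fwdDiff v φ z • w := by
      ext z
      simp only [fwdDiff, sub_smul]
    rw [hdiff, mul_right_comm]
    exact ih (hφ v)

lemma integral {Ω : Type*} [MeasurableSpace Ω] {μ : Measure Ω} [IsFiniteMeasure μ]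
    {G : Ω → E → F} (hG : ∀ᵐ ω ∂μ, BoundedDifferences k C (G ω))
    (hint : ∀ z, Integrable (fun ω => G ω z) μ) :
    BoundedDifferences k (C * μ.real Set.univ) fun z => ∫ ω, G ω z ∂μ := by
  induction k generalizing C G with
  | zero => exact fun z => norm_integral_le_of_norm_le_const (hG.mono fun ω hω => hω z)
  | succ k ih =>
    intro v
    have hdiff : fwdDiff v (fun z => ∫ ω, G ω z ∂μ) = fun z => ∫ ω, fwdDiff v (G ω) z ∂μ := by
      ext z
      exact (integral_sub (hint (z + v)) (hint z)).symm
    rw [hdiff, mul_right_comm]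
    exact ih (hG.mono fun ω hω => hω v) fun z => (hint (z + v)).sub (hint z)

variable [NormedSpace ℝ E]

lemma of_norm_iteratedFDeriv_le {g : E → F} (hg : ContDiff ℝ k g)
    (hC : ∀ z, ‖iteratedFDeriv ℝ k g z‖ ≤ C) : BoundedDifferences k C g := by
  induction k generalizing C g with
  | zero => exact fun z => by simpa only [norm_iteratedFDeriv_zero] using hC z
  | succ k ih =>
    intro v
    have hgk : ContDiff ℝ k g := hg.of_le (by exact_mod_cast k.le_succ)
    have hgv : ContDiff ℝ k fun z => g (z + v) := hgk.comp (contDiff_id.add contDiff_const)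
    refine ih (hgv.sub hgk) fun z => ?_
    have hdiff : iteratedFDeriv ℝ k (fwdDiff v g) z =
        iteratedFDeriv ℝ k g (z + v) - iteratedFDeriv ℝ k g z := by
      rw [← iteratedFDeriv_comp_add_right]
      exact iteratedFDeriv_sub_apply hgv.contDiffAt hgk.contDiffAt
    rw [hdiff]
    simpa using convex_univ.norm_image_sub_le_of_norm_fderiv_le (𝕜 := ℝ)
      (fun y _ => hg.differentiable_iteratedFDeriv (by exact_mod_cast k.lt_succ_self) y)
      (fun y _ => norm_fderiv_iteratedFDeriv.trans_le (hC y))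
      (Set.mem_univ z) (Set.mem_univ (z + v))

lemma exists_of_contDiff_of_hasCompactSupport {g : E → F} (hg : ContDiff ℝ k g)
    (hgs : HasCompactSupport g) : ∃ C, 0 ≤ C ∧ BoundedDifferences k C g := by
  obtain ⟨C, hC⟩ := (hgs.iteratedFDeriv k).exists_bound_of_continuous
    (hg.continuous_iteratedFDeriv' (m := k))
  exact ⟨C, (norm_nonneg _).trans (hC 0), of_norm_iteratedFDeriv_le hg hC⟩

end BoundedDifferences

end BoundedDifferences

section Harmonic

variable {E : Type*} [NormedAddCommGroup E] [InnerProductSpace ℝ E] [FiniteDimensional ℝ E]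
  [MeasurableSpace E] [BorelSpace E]

lemma exists_boundedDifferences_meanKernel_mul (k : ℕ) :
    ∃ C, 0 ≤ C ∧ ∀ w : E, BoundedDifferences k C fun z => meanKernel z * meanKernel (w - z) := by
  have hsmooth : ContDiff ℝ k fun p : E × E => meanKernel p.2 * meanKernel (p.1 - p.2) :=
    (contDiff_meanKernel.comp contDiff_snd).mul
      (contDiff_meanKernel.comp (contDiff_fst.sub contDiff_snd))
  have hsupport : HasCompactSupport fun p : E × E => meanKernel p.2 * meanKernel (p.1 - p.2) := by
    refine hasCompactSupport_of_eq_zero 2 fun p hp => ?_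
    rcases le_total 1 ‖p.2‖ with h2 | h2
    · rw [meanKernel_eq_zero h2, zero_mul]
    · have h1 : 2 ≤ ‖p.1‖ := by
        rcases le_max_iff.1 hp with h | h <;> linarith
      rw [meanKernel_eq_zero (y := p.1 - p.2) (by linarith [norm_sub_norm_le p.1 p.2]), mul_zero]
  obtain ⟨C, hC0, hC⟩ :=
    BoundedDifferences.exists_of_contDiff_of_hasCompactSupport hsmooth hsupport
  refine ⟨C * ‖ContinuousLinearMap.inr ℝ E E‖ ^ k, by positivity, fun w => ?_⟩
  simpa using hC.comp_add_clm hC0 (w, 0) (ContinuousLinearMap.inr ℝ E E)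

lemma meanKernel_smul_eq_setIntegral {F : Type*} [NormedAddCommGroup F] [NormedSpace ℝ F]
    [CompleteSpace F] {f : E → F} {x : E} {r : ℝ} (hf : HarmonicOnNhd f (closedBall x (2 * |r|)))
    (z : E) :
    meanKernel z • f (x + r • z) =
      ∫ w in closedBall 0 2, (meanKernel z * meanKernel (w - z)) • f (x + r • w) := by
  rcases le_total 1 ‖z‖ with hz | hz
  · simp only [meanKernel_eq_zero hz, zero_smul, zero_mul, integral_zero]
  have hball : closedBall (x + r • z) |r| ⊆ closedBall x (2 * |r|) := by
    refine closedBall_subset_closedBall' ?_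
    linarith [mem_closedBall.1 (add_smul_mem_closedBall hz x r)]
  rw [setIntegral_eq_integral_of_forall_compl_eq_zero fun w hw => ?_]
  · simp_rw [mul_smul]
    rw [integral_smul, ← integral_add_right_eq_self _ z, ← integral_meanKernel_smul (hf.mono hball)]
    simp only [add_sub_cancel_right, smul_add, ← add_assoc, add_right_comm x]
  · rw [mem_closedBall_zero_iff, not_le] at hw
    rw [meanKernel_eq_zero (y := w - z) (by linarith [norm_sub_norm_le w z]), mul_zero, zero_smul]

theorem exists_boundedDifferences_meanKernel_smul (F : Type*) [NormedAddCommGroup F]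
    [NormedSpace ℝ F] [CompleteSpace F] (k : ℕ) :
    ∃ C, 0 ≤ C ∧ ∀ (f : E → F) (x : E) (r N : ℝ), HarmonicOnNhd f (closedBall x (2 * |r|)) →
      (∀ y ∈ closedBall x (2 * |r|), ‖f y‖ ≤ N) →
      BoundedDifferences k (C * N) fun z => meanKernel z • f (x + r • z) := by
  obtain ⟨C, hC0, hC⟩ := exists_boundedDifferences_meanKernel_mul (E := E) k
  refine ⟨C * volume.real (closedBall (0 : E) 2), by positivity, fun f x r N hf hN => ?_⟩
  have hmem (w) (hw : w ∈ closedBall (0 : E) 2) : x + r • w ∈ closedBall x (2 * |r|) :=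
    add_smul_mem_closedBall (mem_closedBall_zero_iff.1 hw) x r
  have hcont : ContinuousOn (fun w => f (x + r • w)) (closedBall 0 2) :=
    hf.continuousOn.comp (by fun_prop) hmem
  have hfin : IsFiniteMeasure (volume.restrict (closedBall (0 : E) 2)) :=
    ⟨by simpa using measure_closedBall_lt_top⟩
  simp_rw [meanKernel_smul_eq_setIntegral hf]
  rw [mul_right_comm, ← measureReal_restrict_apply_univ]
  refine BoundedDifferences.integral ?_ fun z => ?_
  · filter_upwards [ae_restrict_mem isClosed_closedBall.measurableSet] with w hw
    exact ((hC w).smul_const (f (x + r • w))).mono (by gcongr; exact hN _ (hmem w hw))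
  · have hkernel : Continuous fun w : E => meanKernel z * meanKernel (w - z) :=
      continuous_const.mul (continuous_meanKernel.comp (continuous_id.sub continuous_const))
    exact (hkernel.continuousOn.smul hcont).integrableOn_compact (isCompact_closedBall 0 2)

end Harmonic

section Quadrature

variable {ι F : Type*} [Fintype ι] [NormedAddCommGroup F]

/-- The lattice points of sup norm at most `N`. -/
noncomputable def latticeBox (ι : Type*) [Fintype ι] [DecidableEq ι] (N : ℕ) : Finset (ι → ℤ) :=
  Fintype.piFinset fun _ => Finset.Icc (-N : ℤ) N

lemma mem_latticeBox [DecidableEq ι] {N : ℕ} {n : ι → ℤ} :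
    n ∈ latticeBox ι N ↔ ∀ j, |n j| ≤ N := by
  simp only [latticeBox, Fintype.mem_piFinset, Finset.mem_Icc, abs_le]

lemma card_latticeBox [DecidableEq ι] (N : ℕ) :
    (latticeBox ι N).card = (2 * N + 1) ^ Fintype.card ι := by
  have hcard : (Finset.Icc (-N : ℤ) N).card = 2 * N + 1 := by
    rw [Int.card_Icc]
    omega
  simp only [latticeBox, Fintype.card_piFinset, hcard, Finset.prod_const, Finset.card_univ]

lemma add_one_le_norm_of_notMem_latticeBox [DecidableEq ι] {N : ℕ} {n : ι → ℤ}
    (hn : n ∉ latticeBox ι N) : (N : ℝ) + 1 ≤ ‖fun j => (n j : ℝ)‖ := by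
  obtain ⟨j, hj⟩ : ∃ j, (N : ℤ) < |n j| := by
    simpa only [mem_latticeBox, not_forall, not_le] using hn
  calc (N : ℝ) + 1 ≤ ‖(n j : ℝ)‖ := by
        rw [Real.norm_eq_abs]
        exact_mod_cast hj
    _ ≤ ‖fun j => (n j : ℝ)‖ := norm_le_pi_norm (fun j => (n j : ℝ)) j

lemma eq_zero_of_notMem_latticeBox [DecidableEq ι] {g : (ι → ℝ) → F} {r : ℕ}
    (hr : ∀ z, r < ‖z‖ → g z = 0) {n : ι → ℤ} (hn : n ∉ latticeBox ι r) :
    g (fun j => (n j : ℝ)) = 0 :=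
  hr _ ((lt_add_one _).trans_le (add_one_le_norm_of_notMem_latticeBox hn))

lemma norm_tsum_lattice_le_of_eq_zero {g : (ι → ℝ) → F} {r : ℕ} {C : ℝ}
    (hr : ∀ z, r < ‖z‖ → g z = 0) (hC : ∀ z, ‖g z‖ ≤ C) :
    ‖∑' n : ι → ℤ, g fun j => (n j : ℝ)‖ ≤ C * (2 * r + 1) ^ Fintype.card ι := by
  classical
  rw [tsum_eq_sum fun n hn => eq_zero_of_notMem_latticeBox hr hn]
  refine (norm_sum_le_of_le _ fun n _ => hC _).trans_eq ?_
  rw [Finset.sum_const, card_latticeBox, nsmul_eq_mul, mul_comm]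
  push_cast
  rfl

/-- The half-open unit cube `[0, 1)^ι`, a fundamental domain for `ℤ^ι`. -/
def unitCube (ι : Type*) : Set (ι → ℝ) := Set.univ.pi fun _ => Set.Ico 0 1

lemma measurableSet_unitCube {ι : Type*} [Countable ι] : MeasurableSet (unitCube ι) :=
  MeasurableSet.univ_pi fun _ => measurableSet_Ico

lemma volume_unitCube : volume (unitCube ι) = 1 := by
  simp [unitCube, Real.volume_pi_Ico]

instance : IsProbabilityMeasure (volume.restrict (unitCube ι)) :=
  ⟨by rw [Measure.restrict_apply_univ, volume_unitCube]⟩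

lemma norm_le_one_of_mem_unitCube {v : ι → ℝ} (hv : v ∈ unitCube ι) : ‖v‖ ≤ 1 :=
  (pi_norm_le_iff_of_nonneg zero_le_one).2 fun j => by
    obtain ⟨h0, h1⟩ := hv j (Set.mem_univ j)
    rw [Real.norm_eq_abs, abs_of_nonneg h0]
    exact h1.le

lemma integrable_prod_unitCube_add {g : (ι → ℝ) → F} (hg : Integrable g) :
    Integrable (fun p : (ι → ℝ) × (ι → ℝ) => g (p.2 + p.1))
      ((volume.restrict (unitCube ι)).prod volume) := by
  simpa only [add_comm, Function.comp_def] using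
    (measurePreserving_prod_add (volume.restrict (unitCube ι)) volume).integrable_comp_of_integrable
      (hg.comp_snd (volume.restrict (unitCube ι)))

variable [NormedSpace ℝ F]

/-- The average of `g` over the translate of the unit cube with corner `z`. -/
noncomputable def unitCubeAverage (g : (ι → ℝ) → F) (z : ι → ℝ) : F :=
  ∫ v in unitCube ι, g (z + v)

lemma hasSum_unitCubeAverage {g : (ι → ℝ) → F} (hg : Integrable g) :
    HasSum (fun n : ι → ℤ => unitCubeAverage g fun j => (n j : ℝ)) (∫ z, g z) := by
  let cube (n : ι → ℤ) : Set (ι → ℝ) := Set.univ.pi fun j => Set.Ico (n j : ℝ) (n j + 1)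
  have hcover : ⋃ n, cube n = Set.univ := by
    rw [Set.iUnion_univ_pi fun (_ : ι) (m : ℤ) => Set.Ico (m : ℝ) (m + 1)]
    simp only [iUnion_Ico_intCast, Set.pi_univ]
  have hdisjoint : Pairwise (Function.onFun Disjoint cube) := fun m n hmn => by
    obtain ⟨j, hj⟩ := Function.ne_iff.1 hmn
    exact Set.disjoint_univ_pi.2 ⟨j, Set.pairwise_disjoint_Ico_intCast ℝ hj⟩
  have htranslate (n : ι → ℤ) :
      ∫ z in cube n, g z = unitCubeAverage g fun j => (n j : ℝ) := by
    rw [← (measurePreserving_add_left volume fun j => (n j : ℝ)).setIntegral_preimage_emb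
      (measurableEmbedding_addLeft _) g (cube n)]
    have hpreimage : (fun z => (fun j => (n j : ℝ)) + z) ⁻¹' cube n = unitCube ι := by
      ext z
      simp [cube, unitCube]
    rw [hpreimage, unitCubeAverage]
  have hsum := hasSum_integral_iUnion (μ := volume)
    (fun n => MeasurableSet.univ_pi fun _ => measurableSet_Ico) hdisjoint hg.integrableOn
  simpa only [hcover, setIntegral_univ, htranslate] using hsum

lemma integrable_unitCubeAverage {g : (ι → ℝ) → F} (hg : Integrable g) :
    Integrable (unitCubeAverage g) :=
  (integrable_prod_unitCube_add hg).integral_prod_right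

lemma integral_unitCubeAverage [CompleteSpace F] {g : (ι → ℝ) → F} (hg : Integrable g) :
    ∫ z, unitCubeAverage g z = ∫ z, g z := by
  simp_rw [unitCubeAverage]
  rw [← integral_integral_swap (integrable_prod_unitCube_add hg)]
  simp only [integral_add_right_eq_self, integral_const, probReal_univ, one_smul]

lemma unitCubeAverage_sub_self [CompleteSpace F] {g : (ι → ℝ) → F} (hg : Integrable g)
    (z : ι → ℝ) : unitCubeAverage g z - g z = ∫ v in unitCube ι, fwdDiff v g z := by
  simp only [fwdDiff]
  rw [integral_sub (hg.comp_add_left z).integrableOn (integrable_const _), integral_const,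
    probReal_univ, one_smul, unitCubeAverage]

lemma BoundedDifferences.unitCubeAverage_sub_self [CompleteSpace F] {k : ℕ} {C : ℝ}
    {g : (ι → ℝ) → F} (hg : Integrable g) (hC : 0 ≤ C) (hgC : BoundedDifferences (k + 1) C g) :
    BoundedDifferences k C fun z => unitCubeAverage g z - g z := by
  simp_rw [HarmFilt.unitCubeAverage_sub_self hg]
  rw [← mul_one C, ← probReal_univ (μ := volume.restrict (unitCube ι))]
  refine BoundedDifferences.integral ?_ fun z =>
    (hg.comp_add_left z).integrableOn.sub (integrable_const _)
  filter_upwards [ae_restrict_mem measurableSet_unitCube] with v hv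
  exact (hgC v).mono (mul_le_of_le_one_right hC (norm_le_one_of_mem_unitCube hv))

lemma unitCubeAverage_eq_zero {g : (ι → ℝ) → F} {r : ℝ} (hr : ∀ z, r < ‖z‖ → g z = 0)
    {z : ι → ℝ} (hz : r + 1 < ‖z‖) : unitCubeAverage g z = 0 :=
  setIntegral_eq_zero_of_forall_eq_zero fun v hv =>
    hr _ (by linarith [norm_sub_le_norm_add z v, norm_le_one_of_mem_unitCube hv])

/-- The error made when the integral of `g` is replaced by its sum over `ℤ^ι`. -/
noncomputable def quadratureError (g : (ι → ℝ) → F) : F :=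
  (∫ z, g z) - ∑' n : ι → ℤ, g fun j => (n j : ℝ)

/-- Unit cube averages are integrated exactly by the lattice sum. -/
lemma quadratureError_unitCubeAverage_sub_self [CompleteSpace F] {g : (ι → ℝ) → F}
    (hg : Integrable g) (hsum : Summable fun n : ι → ℤ => g fun j => (n j : ℝ)) :
    quadratureError (fun z => unitCubeAverage g z - g z) = -quadratureError g := by
  have hA := hasSum_unitCubeAverage hg
  rw [quadratureError, quadratureError, integral_sub (integrable_unitCubeAverage hg) hg,
    integral_unitCubeAverage hg, hA.summable.tsum_sub hsum, hA.tsum_eq, sub_self, zero_sub]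

lemma norm_integral_le_of_eq_zero {g : (ι → ℝ) → F} {r : ℕ} {C : ℝ}
    (hr : ∀ z, r < ‖z‖ → g z = 0) (hC : ∀ z, ‖g z‖ ≤ C) :
    ‖∫ z, g z‖ ≤ C * (2 * r) ^ Fintype.card ι := by
  rw [← setIntegral_eq_integral_of_forall_compl_eq_zero (s := closedBall 0 r) fun z hz => hr z ?_]
  · refine (norm_setIntegral_le_of_norm_le_const measure_closedBall_lt_top
      fun z _ => hC z).trans_eq ?_
    rw [Measure.real, Real.volume_pi_closedBall _ r.cast_nonneg,
      ENNReal.toReal_ofReal (by positivity)]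
  · simpa using hz

theorem norm_quadratureError_le [CompleteSpace F] {k : ℕ} {C : ℝ} (hC : 0 ≤ C)
    {g : (ι → ℝ) → F} (hg : Integrable g) {r : ℕ} (hr : ∀ z, r < ‖z‖ → g z = 0)
    (hgC : BoundedDifferences k C g) :
    ‖quadratureError g‖ ≤ 2 * C * (2 * (r + k) + 1) ^ Fintype.card ι := by
  classical
  induction k generalizing g r with
  | zero =>
    calc ‖quadratureError g‖ ≤ C * (2 * r) ^ Fintype.card ι + C * (2 * r + 1) ^ Fintype.card ι :=
          (norm_sub_le _ _).trans (add_le_add (norm_integral_le_of_eq_zero hr hgC)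
            (norm_tsum_lattice_le_of_eq_zero hr hgC))
      _ ≤ C * (2 * r + 1) ^ Fintype.card ι + C * (2 * r + 1) ^ Fintype.card ι := by
          gcongr
          linarith
      _ = 2 * C * (2 * (r + (0 : ℕ)) + 1) ^ Fintype.card ι := by push_cast; ring
  | succ k ih =>
    have hsum : Summable fun n : ι → ℤ => g fun j => (n j : ℝ) :=
      summable_of_ne_finset_zero (s := latticeBox ι r) fun _ hn =>
        eq_zero_of_notMem_latticeBox hr hn
    rw [← norm_neg, ← quadratureError_unitCubeAverage_sub_self hg hsum]
    refine (ih ((integrable_unitCubeAverage hg).sub hg) (r := r + 1) (fun z hz => ?_)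
      (hgC.unitCubeAverage_sub_self hg hC)).trans_eq ?_
    · push_cast at hz
      rw [Pi.sub_apply, unitCubeAverage_eq_zero hr hz, hr z (by linarith), sub_zero]
    · push_cast
      ring

end Quadrature

section ScaledMeanIntegrand

variable {d : ℕ} {F : Type*} [NormedAddCommGroup F] [NormedSpace ℝ F]

lemma integrable_meanKernel_smul {E : Type*} [NormedAddCommGroup E] [InnerProductSpace ℝ E]
    [FiniteDimensional ℝ E] [MeasurableSpace E] [BorelSpace E] {f : E → F} {x : E} {r : ℝ}
    (hf : HarmonicOnNhd f (closedBall x |r|)) :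
    Integrable fun z : E => meanKernel z • f (x + r • z) := by
  have hmem (z) (hz : z ∈ closedBall (0 : E) 1) : x + r • z ∈ closedBall x |r| := by
    simpa only [one_mul] using add_smul_mem_closedBall (mem_closedBall_zero_iff.1 hz) x r
  refine (integrableOn_iff_integrable_of_support_subset (s := closedBall 0 1) fun z hz => ?_).1
    ((continuous_meanKernel.continuousOn.smul
      (hf.continuousOn.comp (by fun_prop) hmem)).integrableOn_compact (isCompact_closedBall 0 1))
  by_contra hz1
  rw [mem_closedBall_zero_iff, not_le] at hz1
  exact hz (by simp only [meanKernel_eq_zero hz1.le, zero_smul])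

/-- The integrand of the mean value formula for `f` at `x`, averaged at scale `h⁻¹` and read in the
coordinates of `ℝ^d`; the factor `h ^ d` that makes its integral equal to `f x` is left out. -/
noncomputable def scaledMeanIntegrand (f : EuclideanSpace ℝ (Fin d) → F)
    (x : EuclideanSpace ℝ (Fin d)) (h : ℝ) (y : Fin d → ℝ) : F :=
  meanKernel (h • WithLp.toLp 2 y) • f (x - WithLp.toLp 2 y)

variable {f : EuclideanSpace ℝ (Fin d) → F} {x : EuclideanSpace ℝ (Fin d)} {h : ℝ}

lemma scaledMeanIntegrand_eq_comp (hh : h ≠ 0) :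
    scaledMeanIntegrand f x h =
      (fun y => (fun z => meanKernel z • f (x + (-h⁻¹) • z)) (h • y)) ∘ WithLp.toLp 2 := by
  ext y
  simp only [scaledMeanIntegrand, Function.comp_apply, neg_smul, inv_smul_smul₀ hh, sub_eq_add_neg]

lemma scaledMeanIntegrand_eq_zero (hh : 0 < h) {y : Fin d → ℝ} (hy : h⁻¹ ≤ ‖y‖) :
    scaledMeanIntegrand f x h y = 0 := by
  have hy' : 1 ≤ ‖h • WithLp.toLp 2 y‖ := by
    rw [norm_smul, Real.norm_of_nonneg hh.le, ← inv_le_iff_one_le_mul₀' hh]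
    exact hy.trans ((pi_norm_le_iff_of_nonneg (norm_nonneg _)).2 fun i =>
      PiLp.norm_apply_le (WithLp.toLp 2 y) i)
  rw [scaledMeanIntegrand, meanKernel_eq_zero hy', zero_smul]

lemma integrable_scaledMeanIntegrand (hh : 0 < h) (hf : HarmonicOnNhd f (closedBall x h⁻¹)) :
    Integrable (scaledMeanIntegrand f x h) := by
  rw [scaledMeanIntegrand_eq_comp hh.ne']
  refine (PiLp.volume_preserving_toLp (Fin d)).integrable_comp_of_integrable
    ((integrable_meanKernel_smul ?_).comp_smul hh.ne')
  rwa [abs_neg, abs_of_pos (inv_pos.2 hh)]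

lemma pow_smul_integral_scaledMeanIntegrand [CompleteSpace F] (hh : 0 < h)
    (hf : HarmonicOnNhd f (closedBall x h⁻¹)) :
    h ^ d • ∫ y, scaledMeanIntegrand f x h y = f x := by
  let g (z : EuclideanSpace ℝ (Fin d)) : F := meanKernel z • f (x + (-h⁻¹) • z)
  have hmean : ∫ z, g z = f x :=
    integral_meanKernel_smul (by rwa [abs_neg, abs_of_pos (inv_pos.2 hh)])
  calc h ^ d • ∫ y, scaledMeanIntegrand f x h y
      = h ^ d • ∫ y : EuclideanSpace ℝ (Fin d), g (h • y) := by
        rw [scaledMeanIntegrand_eq_comp hh.ne']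
        exact congrArg _ ((PiLp.volume_preserving_toLp (Fin d)).integral_comp
          (MeasurableEquiv.toLp 2 (Fin d → ℝ)).measurableEmbedding fun z => g (h • z))
    _ = ∫ z, g z := by
        rw [Measure.integral_comp_smul_of_nonneg _ _ _ (hR := hh.le), finrank_euclideanSpace_fin,
          smul_inv_smul₀ (pow_pos hh d).ne']
    _ = f x := hmean

variable (d F) in
lemma exists_boundedDifferences_scaledMeanIntegrand [CompleteSpace F] (k : ℕ) :
    ∃ C, 0 ≤ C ∧ ∀ (f : EuclideanSpace ℝ (Fin d) → F) (x : EuclideanSpace ℝ (Fin d)) (h N : ℝ),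
      0 < h → 0 ≤ N → HarmonicOnNhd f (closedBall x (2 * h⁻¹)) →
      (∀ y ∈ closedBall x (2 * h⁻¹), ‖f y‖ ≤ N) →
      BoundedDifferences k (C * N * h ^ k) (scaledMeanIntegrand f x h) := by
  obtain ⟨C, hC0, hC⟩ := exists_boundedDifferences_meanKernel_smul
    (E := EuclideanSpace ℝ (Fin d)) F k
  let toLp : (Fin d → ℝ) →L[ℝ] EuclideanSpace ℝ (Fin d) :=
    (PiLp.continuousLinearEquiv 2 ℝ fun _ : Fin d => ℝ).symm
  refine ⟨C * ‖toLp‖ ^ k, by positivity, fun f x h N hh hN hf hfN => ?_⟩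
  have habs : |-h⁻¹| = h⁻¹ := by rw [abs_neg, abs_of_pos (inv_pos.2 hh)]
  have hbound := (hC f x (-h⁻¹) N (by rwa [habs]) (by rwa [habs])).comp_add_clm (by positivity)
    0 (h • toLp)
  simp only [zero_add] at hbound
  rw [scaledMeanIntegrand_eq_comp hh.ne']
  refine hbound.mono ?_
  rw [norm_smul, Real.norm_of_nonneg hh.le]
  exact (by ring : _ = _).le

end ScaledMeanIntegrand

section MeanFilter

variable {d : ℕ}

/-- The mesh of the rescaled lattice used by the filter of order `T`. The averaging radius is half
of `T + 1`, so that functions are evaluated in a ball of radius `T + 1` only. -/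
noncomputable def mesh (T : ℕ) : ℝ := 2 / (T + 1)

lemma mesh_pos (T : ℕ) : 0 < mesh T := by
  unfold mesh
  positivity

lemma two_mul_inv_mesh (T : ℕ) : 2 * (mesh T)⁻¹ = T + 1 := by
  rw [mesh, inv_div, mul_div_cancel₀ _ two_ne_zero]

lemma mesh_mul_two_mul_add_le (T k : ℕ) : mesh T * (2 * (T + 1 + k) + 1) ≤ 2 * (2 * k + 3) := by
  rw [mesh, div_mul_eq_mul_div, div_le_iff₀ (by positivity)]
  nlinarith [mul_nonneg (k.cast_nonneg : (0 : ℝ) ≤ k) (T.cast_nonneg : (0 : ℝ) ≤ T)]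

lemma mesh_pow_mul_rpow_le (d T : ℕ) :
    mesh T ^ d * (2 * (T : ℝ) + 1) ^ ((d : ℝ) / 2) ≤
      4 ^ d / (2 * (T : ℝ) + 1) ^ ((d : ℝ) / 2) := by
  have hmesh : mesh T * (2 * T + 1) ≤ 4 := by
    rw [mesh, div_mul_eq_mul_div, div_le_iff₀ (by positivity)]
    linarith
  have hmesh0 := mesh_pos T
  rw [le_div_iff₀ (by positivity), mul_assoc, ← Real.rpow_add (by positivity), add_halves,
    Real.rpow_natCast, ← mul_pow]
  gcongr

lemma mesh_pow_le (d T : ℕ) :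
    mesh T ^ d ≤ 4 ^ d * (2 * (T : ℝ) + 1) ^ (-((d : ℝ) / 2)) := by
  rw [Real.rpow_neg (by positivity), ← div_eq_mul_inv]
  refine le_trans ?_ (mesh_pow_mul_rpow_le d T)
  exact le_mul_of_one_le_right (pow_pos (mesh_pos T) d).le
    (Real.one_le_rpow (by linarith [T.cast_nonneg (α := ℝ)]) (by positivity))

/-- The discretization at scale `mesh T` of the averaging against `meanKernel`, as a filter of
order at most `T`. -/
noncomputable def meanFilter (d T : ℕ) : LatticeFilter d :=
  Finsupp.indicator (latticeBox (Fin d) T) fun n _ =>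
    ((mesh T ^ d * meanKernel (mesh T • latticePoint n) : ℝ) : ℂ)

lemma latticeNorm_le_iff {n : Lattice d} {N : ℕ} : latticeNorm n ≤ N ↔ ∀ i, |n i| ≤ N := by
  simp only [latticeNorm, Finset.sup_le_iff, Finset.mem_univ, true_imp_iff]
  refine forall_congr' fun i => ?_
  rw [Int.abs_eq_natAbs]
  exact Nat.cast_le.symm

lemma latticePoint_sub (m n : Lattice d) :
    latticePoint (m - n) = latticePoint m - latticePoint n := by
  ext i
  simp [latticePoint]

lemma orderLE_meanFilter (d T : ℕ) : OrderLE (meanFilter d T) T := fun _ hn =>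
  Finsupp.indicator_of_notMem
    (fun hmem => hn.not_ge (latticeNorm_le_iff.2 (mem_latticeBox.1 hmem))) _

lemma applyFilter_meanFilter (T : ℕ) (f : EuclideanSpace ℝ (Fin d) → ℂ) (τ : Lattice d) :
    applyFilter (meanFilter d T) (fun σ => f (latticePoint σ)) τ =
      mesh T ^ d • ∑ n ∈ latticeBox (Fin d) T,
        scaledMeanIntegrand f (latticePoint τ) (mesh T) fun j => (n j : ℝ) := by
  rw [applyFilter, meanFilter, Finsupp.sum_indicator_index _ (by simp), Finset.smul_sum]
  refine Finset.sum_congr rfl fun n _ => ?_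
  rw [← Complex.real_smul, mul_smul, latticePoint_sub]
  rfl

lemma l2norm_le_of_orderLE {q : LatticeFilter d} {T : ℕ} {B : ℝ} (hq : OrderLE q T)
    (hB : ∀ τ, ‖q τ‖ ≤ B) : l2norm q ≤ B * (2 * (T : ℝ) + 1) ^ ((d : ℝ) / 2) := by
  have hB0 : 0 ≤ B := (norm_nonneg _).trans (hB 0)
  have hsupport : q.support ⊆ latticeBox (Fin d) T := fun n hn =>
    mem_latticeBox.2 (latticeNorm_le_iff.1 (not_lt.1 fun h =>
      Finsupp.mem_support_iff.1 hn (hq n h)))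
  refine Real.sqrt_le_iff.2 ⟨by positivity, ?_⟩
  calc q.sum (fun _ a => ‖a‖ ^ 2) = ∑ n ∈ latticeBox (Fin d) T, ‖q n‖ ^ 2 :=
        Finsupp.sum_of_support_subset q hsupport _ (by simp)
    _ ≤ ∑ n ∈ latticeBox (Fin d) T, B ^ 2 := by gcongr with n; exact hB n
    _ = B ^ 2 * (2 * (T : ℝ) + 1) ^ d := by
        rw [Finset.sum_const, card_latticeBox, Fintype.card_fin, nsmul_eq_mul, mul_comm]
        push_cast
        rfl
    _ = (B * (2 * (T : ℝ) + 1) ^ ((d : ℝ) / 2)) ^ 2 := by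
        rw [mul_pow, sq ((2 * (T : ℝ) + 1) ^ ((d : ℝ) / 2)), ← Real.rpow_add (by positivity),
          add_halves, Real.rpow_natCast]

lemma exists_l2norm_meanFilter_le (d : ℕ) : ∃ C : ℝ, ∀ T : ℕ,
    l2norm (meanFilter d T) ≤ C / (2 * (T : ℝ) + 1) ^ ((d : ℝ) / 2) := by
  obtain ⟨A, hA⟩ := (hasCompactSupport_meanKernel
    (E := EuclideanSpace ℝ (Fin d))).exists_bound_of_continuous continuous_meanKernel
  have hA0 : 0 ≤ A := (norm_nonneg _).trans (hA 0)
  refine ⟨A * 4 ^ d, fun T => ?_⟩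
  have hmesh := mesh_pos T
  have hcoeff (n) : ‖meanFilter d T n‖ ≤ A * mesh T ^ d := by
    rw [meanFilter, Finsupp.indicator_apply]
    split_ifs
    · rw [Complex.norm_real, norm_mul, Real.norm_of_nonneg (by positivity), mul_comm]
      gcongr
      exact hA _
    · rw [norm_zero]
      positivity
  refine (l2norm_le_of_orderLE (orderLE_meanFilter d T) hcoeff).trans ?_
  rw [mul_assoc, mul_div_assoc]
  gcongr
  exact mesh_pow_mul_rpow_le d T

lemma sub_applyFilter_meanFilter {T : ℕ} {f : EuclideanSpace ℝ (Fin d) → ℂ} {τ : Lattice d}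
    (hf : HarmonicOnNhd f (closedBall (latticePoint τ) (T + 1))) :
    f (latticePoint τ) - applyFilter (meanFilter d T) (fun σ => f (latticePoint σ)) τ =
      mesh T ^ d • quadratureError (scaledMeanIntegrand f (latticePoint τ) (mesh T)) := by
  have hmesh := mesh_pos T
  have hradius := two_mul_inv_mesh T
  have hball := closedBall_subset_closedBall (x := (latticePoint τ))
    (by linarith [inv_pos.2 hmesh] : (mesh T)⁻¹ ≤ T + 1)
  rw [quadratureError, smul_sub, pow_smul_integral_scaledMeanIntegrand hmesh (hf.mono hball),
    applyFilter_meanFilter, tsum_eq_sum fun n hn => ?_]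
  exact scaledMeanIntegrand_eq_zero hmesh
    (by linarith [inv_pos.2 hmesh, add_one_le_norm_of_notMem_latticeBox hn])

theorem exists_norm_sub_applyFilter_meanFilter_le (d : ℕ) : ∃ C : ℝ, 0 ≤ C ∧
    ∀ (T : ℕ) (f : EuclideanSpace ℝ (Fin d) → ℂ) (τ : Lattice d) (N : ℝ), 0 ≤ N →
      HarmonicOnNhd f (closedBall (latticePoint τ) (T + 1)) →
      (∀ y ∈ closedBall (latticePoint τ) (T + 1), ‖f y‖ ≤ N) →
      ‖f (latticePoint τ) - applyFilter (meanFilter d T) (fun σ => f (latticePoint σ)) τ‖ ≤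
        C * (2 * (T : ℝ) + 1) ^ (-((d : ℝ) / 2)) * N := by
  obtain ⟨C, hC0, hC⟩ := exists_boundedDifferences_scaledMeanIntegrand d ℂ d
  refine ⟨2 * C * (2 * (2 * d + 3)) ^ d * 4 ^ d, by positivity, fun T f τ N hN hf hfN => ?_⟩
  have hmesh := mesh_pos T
  have hradius := two_mul_inv_mesh T
  have hball := closedBall_subset_closedBall (x := (latticePoint τ))
    (by linarith [inv_pos.2 hmesh] : (mesh T)⁻¹ ≤ T + 1)
  have hquad := norm_quadratureError_le (k := d) (r := T + 1) (by positivity)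
    (integrable_scaledMeanIntegrand hmesh (hf.mono hball))
    (fun y hy => scaledMeanIntegrand_eq_zero hmesh (by push_cast at hy; linarith [inv_pos.2 hmesh]))
    (hC f (latticePoint τ) (mesh T) N hmesh hN (by rwa [hradius]) (by rwa [hradius]))
  rw [sub_applyFilter_meanFilter hf, norm_smul, Real.norm_of_nonneg (by positivity)]
  have hwidth := pow_le_pow_left₀ (by positivity) (mesh_mul_two_mul_add_le T d) d
  have hscale := mesh_pow_le d T
  calc _ ≤ mesh T ^ d * (2 * (C * N * mesh T ^ d) * (2 * (T + 1 + d) + 1) ^ d) := by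
        simpa using mul_le_mul_of_nonneg_left hquad (pow_pos hmesh d).le
    _ = 2 * C * N * ((mesh T * (2 * (T + 1 + d) + 1)) ^ d * mesh T ^ d) := by rw [mul_pow]; ring
    _ ≤ 2 * C * N * ((2 * (2 * d + 3)) ^ d *
          (4 ^ d * (2 * (T : ℝ) + 1) ^ (-((d : ℝ) / 2)))) :=
        mul_le_mul_of_nonneg_left (mul_le_mul hwidth hscale (by positivity) (by positivity))
          (by positivity)
    _ = _ := by ring

end MeanFilter

section Certification

variable {d : ℕ}

lemma closedBall_subset_interior_box {M : ℕ} {x : EuclideanSpace ℝ (Fin d)} {r : ℝ}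
    (hx : ∀ i, |x i| + r < 2 * M) : closedBall x r ⊆ interior (box d M) := by
  have hopen : IsOpen {y : EuclideanSpace ℝ (Fin d) | ∀ i, |y i| < 2 * (M : ℝ)} := by
    rw [Set.ofPred_forall]
    exact isOpen_iInter_of_finite fun i => isOpen_lt (by fun_prop) continuous_const
  refine fun y hy => interior_maximal (fun y hy i => (hy i).le) hopen fun i => ?_
  have hyx : |y i - x i| ≤ r :=
    (PiLp.norm_apply_le (p := 2) (y - x) i).trans (mem_closedBall_iff_norm.1 hy)
  linarith [hx i, abs_sub_abs_le_abs_sub (y i) (x i)]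

lemma abs_le_latticeNorm (n : Lattice d) (i : Fin d) : |(n i : ℝ)| ≤ latticeNorm n := by
  exact_mod_cast latticeNorm_le_iff.1 le_rfl i

lemma closedBall_latticePoint_subset_interior_box {M L T : ℕ} {t τ : Lattice d} (hM : 0 < M)
    (ht : 4 * (latticeNorm t : ℝ) ≤ M) (hL : 4 * (L : ℝ) ≤ M) (hτ : latticeNorm (τ - t) ≤ L)
    (hT : T ≤ L) : closedBall (latticePoint τ) (T + 1) ⊆ interior (box d M) := by
  have hM1 : (1 : ℝ) ≤ M := by exact_mod_cast hM
  have hτL : (latticeNorm (τ - t) : ℝ) ≤ L := by exact_mod_cast hτ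
  have hTL : (T : ℝ) ≤ L := by exact_mod_cast hT
  refine closedBall_subset_interior_box fun i => ?_
  have hτt : |(τ i : ℝ) - t i| ≤ latticeNorm (τ - t) := by
    simpa using abs_le_latticeNorm (τ - t) i
  have hτi : |latticePoint τ i| ≤ |(t i : ℝ)| + |(τ i : ℝ) - t i| := by
    simpa [latticePoint] using abs_add_le (t i : ℝ) ((τ i : ℝ) - t i)
  linarith [abs_le_latticeNorm t i]

lemma norm_le_toReal_boxNorm {M : ℕ} {f : EuclideanSpace ℝ (Fin d) → ℂ}
    (hf : boxNorm M f ≠ ∞) {x : EuclideanSpace ℝ (Fin d)} (hx : x ∈ box d M) :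
    ‖f x‖ ≤ (boxNorm M f).toReal := by
  rw [← toReal_enorm]
  exact ENNReal.toReal_mono hf (le_iSup₂ (f := fun x (_ : x ∈ box d M) => ‖f x‖ₑ) x hx)

lemma exists_enorm_sub_applyFilter_meanFilter_le (d : ℕ) : ∃ C₀ : ℝ,
    ∀ (T M : ℕ) (f : EuclideanSpace ℝ (Fin d) → ℂ) (τ : Lattice d) (C : ℝ), 0 < C → C₀ ≤ C →
      HarmonicOnNhd f (interior (box d M)) →
      closedBall (latticePoint τ) (T + 1) ⊆ interior (box d M) →
      ‖f (latticePoint τ) - applyFilter (meanFilter d T) (fun σ => f (latticePoint σ)) τ‖ₑ ≤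
        ENNReal.ofReal (C * (2 * (T : ℝ) + 1) ^ (-((d : ℝ) / 2))) * boxNorm M f := by
  obtain ⟨C₀, -, hC₀⟩ := exists_norm_sub_applyFilter_meanFilter_le d
  refine ⟨C₀, fun T M f τ C hC hC₀C hf hball => ?_⟩
  have hfactor : 0 < C * (2 * (T : ℝ) + 1) ^ (-((d : ℝ) / 2)) := by positivity
  rcases eq_or_ne (boxNorm M f) ∞ with htop | htop
  · rw [htop, ENNReal.mul_top (ENNReal.ofReal_pos.2 hfactor).ne']
    exact le_top
  rw [← ENNReal.ofReal_toReal htop, ← ENNReal.ofReal_mul hfactor.le, ← ofReal_norm]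
  refine ENNReal.ofReal_le_ofReal ((hC₀ T f τ _ ENNReal.toReal_nonneg (hf.mono hball)
    fun y hy => norm_le_toReal_boxNorm htop (interior_subset (hball hy))).trans ?_)
  gcongr

lemma eLpNorm_two_le_of_enorm_le {Ω E : Type*} [MeasurableSpace Ω] [NormedAddCommGroup E]
    {P : Measure Ω} {g : Ω → E} {b : Ω → ℝ≥0∞} {K R : ℝ} (hK : 0 ≤ K) (hR : 0 ≤ R)
    (hg : ∀ ω, ‖g ω‖ₑ ≤ ENNReal.ofReal K * b ω)
    (hb : ∫⁻ ω, b ω ^ 2 ∂P ≤ ENNReal.ofReal (R ^ 2)) :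
    eLpNorm g 2 P ≤ ENNReal.ofReal (K * R) := by
  rw [eLpNorm_eq_lintegral_rpow_enorm_toReal two_ne_zero ENNReal.ofNat_ne_top, one_div,
    ENNReal.rpow_inv_le_iff (by norm_num)]
  simp only [ENNReal.toReal_ofNat, ENNReal.rpow_ofNat]
  calc ∫⁻ ω, ‖g ω‖ₑ ^ 2 ∂P ≤ ∫⁻ ω, ENNReal.ofReal K ^ 2 * b ω ^ 2 ∂P := by
        refine lintegral_mono fun ω => ?_
        rw [← mul_pow]
        exact pow_le_pow_left₀ zero_le (hg ω) 2
    _ = ENNReal.ofReal K ^ 2 * ∫⁻ ω, b ω ^ 2 ∂P := lintegral_const_mul' _ _ (by simp)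
    _ ≤ ENNReal.ofReal K ^ 2 * ENNReal.ofReal (R ^ 2) := by gcongr
    _ = ENNReal.ofReal (K * R) ^ 2 := by
        rw [ENNReal.ofReal_pow hR, ← mul_pow, ← ENNReal.ofReal_mul hK]

theorem eventually_certifies_meanFilter (d : ℕ) : ∀ᶠ C : ℝ in atTop,
    ∀ M : ℕ, 0 < M → ∀ R : ℝ, 0 ≤ R → ∀ (Ω : Type*) [MeasurableSpace Ω] (P : Measure Ω),
    ∀ s ∈ randomHarmonicFields d M R P, ∀ (t : Lattice d) (L : ℕ),
      (latticeNorm t : ℝ) ≤ C⁻¹ * M → (L : ℝ) ≤ C⁻¹ * M →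
      ∀ T ≤ L, Certifies P (meanFilter d T) s t L (C * R) C T := by
  obtain ⟨C₁, hl2norm⟩ := exists_l2norm_meanFilter_le d
  obtain ⟨C₂, herror⟩ := exists_enorm_sub_applyFilter_meanFilter_le d
  filter_upwards [eventually_ge_atTop C₁, eventually_ge_atTop C₂, eventually_ge_atTop 4]
    with C hC₁ hC₂ hC4 M hM R hR Ω _ P s hs t L ht hL T hT
  obtain ⟨f, ⟨-, hf, hfR⟩, rfl⟩ := hs
  have hC : 0 < C := by linarith
  have hquarter : 4 * (C⁻¹ * M) ≤ M := by
    rw [← mul_assoc, ← div_eq_mul_inv]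
    exact mul_le_of_le_one_left M.cast_nonneg ((div_le_one hC).2 hC4)
  refine ⟨orderLE_meanFilter d T, (hl2norm T).trans (by gcongr), fun τ hτ => ?_⟩
  have hball : closedBall (latticePoint τ) (T + 1) ⊆ interior (box d M) :=
    closedBall_latticePoint_subset_interior_box hM (by linarith) (by linarith)
      (by exact_mod_cast hτ) hT
  rw [mul_right_comm]
  exact eLpNorm_two_le_of_enorm_le (by positivity) hR
    (fun ω => herror T M (f ω) τ C hC hC₂ (hf ω).2 hball) hfR

end Certification

end HarmFilt

theorem mainTheorem6_general :
    ∃ q : (d : ℕ) → ℕ → HarmFilt.LatticeFilter d, ∀ D : ℕ, ∃ c : ℝ, 0 < c ∧ c ≤ 1 ∧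
    ∀ d ≤ D, ∀ M : ℕ, 0 < M → ∀ R : ℝ, 0 ≤ R →
    ∀ (Ω : Type*) [MeasurableSpace Ω] (P : Measure Ω),
    ∀ s ∈ HarmFilt.randomHarmonicFields d M R P,
    ∀ (t : HarmFilt.Lattice d) (L : ℕ),
      (HarmFilt.latticeNorm t : ℝ) ≤ c * M → (L : ℝ) ≤ c * M →
      HarmFilt.WellFiltered P s t L (c⁻¹ * R) c⁻¹ ∧
      ∀ T ≤ L, HarmFilt.Certifies P (q d T) s t L (c⁻¹ * R) c⁻¹ T := by
  refine ⟨HarmFilt.meanFilter, fun D => ?_⟩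
  obtain ⟨C, hC1, hC⟩ := ((Filter.eventually_ge_atTop 1).and
    ((Set.finite_Iic D).eventually_all.2 fun d _ =>
      HarmFilt.eventually_certifies_meanFilter d)).exists
  refine ⟨C⁻¹, by positivity, inv_le_one_of_one_le₀ hC1, ?_⟩
  intro d hd M hM R hR Ω _ P s hs t L ht hL
  rw [inv_inv]
  have hcert := hC d hd M hM R hR Ω P s hs t L ht hL
  exact ⟨fun T hT => ⟨_, hcert T (by exact_mod_cast hT)⟩, hcert⟩

theorem mainTheorem6 :
    ∃ c : ℝ, 0 < c ∧ c ≤ 1 ∧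
    ∃ q : (d : ℕ) → ℕ → HarmFilt.LatticeFilter d,
    ∀ d : ℕ, d ≤ 4 → ∀ M : ℕ, 0 < M → ∀ R : ℝ, 0 < R →
    ∀ (Ω : Type*) [MeasurableSpace Ω] (P : MeasureTheory.Measure Ω)
      [MeasureTheory.IsProbabilityMeasure P],
    ∀ s ∈ HarmFilt.randomHarmonicFields d M R P,
    ∀ (t : HarmFilt.Lattice d) (L : ℕ),
      (HarmFilt.latticeNorm t : ℝ) ≤ c * M → (L : ℝ) ≤ c * M →
      HarmFilt.WellFiltered P s t L (c⁻¹ * R) c⁻¹ ∧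
      ∀ T : ℕ, T ≤ L → HarmFilt.Certifies P (q d T) s t L (c⁻¹ * R) c⁻¹ T := by
  obtain ⟨q, hq⟩ := mainTheorem6_general
  obtain ⟨c, hc0, hc1, hcert⟩ := hq 4
  exact ⟨c, hc0, hc1, q, fun d hd M hM R hR Ω _ P _ => hcert d hd M hM R hR.le Ω P⟩
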